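/- Write $S_n$ for the set of permutations $\sigma=\sigma_1\cdots\sigma_n$ of $\{1,\dots,n\}$. A permutation $\sigma\in S_n$ contains the pattern $\tau\in S_k$ if some subsequence $\sigma_{i_1}\cdots\sigma_{i_k}$ with $i_1<\cdots<i_k$ is in the same relative order as $\tau$; otherwise $\sigma$ avoids $\tau$. For a set $T$ of patterns let $S_n(T)$ be the set of $\sigma\in S_n$ that avoid every $\tau\in T$, equipped with the uniform probability measure. Let $\mathrm{LAS}_n(\sigma)$ be the largest $k$ for which there are indices $i_1<\cdots<i_k$ with $\sigma_{i_1}>\sigma_{i_2}<\sigma_{i_3}>\sigma_{i_4}<\cdots\sigma_{i_k}$, and let $E_n^T$ and $\mathrm{SD}_n^T$ be the mean and the standard deviation of $\mathrm{LAS}_n$ on $S_n(T)$. Write $a_n\sim b_n$ for $a_n/b_n\to1$ as $n\to\infty$. (i) If $T=\{132,321\}$ or $T=\{132,231\}$, then $\mathrm{LAS}_n(\sigma)\le 3$ for every $n$ and every $\sigma\in S_n(T)$. (ii) If $T=\{132,312\}$, $T=\{132,123\}$ or $T=\{132,213\}$, then $E_n^T\sim n/2$, $\mathrm{SD}_n^T\sim\sqrt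 n/2$, and $\mathrm{LAS}_n$ is asymptotically normal: for every $t\in\mathbb{R}$, the probability that $(\mathrm{LAS}_n-E_n^T)/\mathrm{SD}_n^T\le t$ converges, as $n\to\infty$, to $\frac{1}{\sqrt{2\pi}}\int_{-\infty}^t e^{-x^2/2}\,dx$. -/

import Mathlib

open MeasureTheory ProbabilityTheory Filter Topology

namespace PermPattern

/-- Permutations of `{0, …, n-1}` carry the discrete σ-algebra. -/
instance instMeasurableSpacePerm (n : ℕ) : MeasurableSpace (Equiv.Perm (Fin n)) := ⊤

instance instDiscreteMeasurableSpacePerm (n : ℕ) :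
    DiscreteMeasurableSpace (Equiv.Perm (Fin n)) := ⟨fun _ => trivial⟩

/-- `σ ∈ S_n` contains the pattern `τ ∈ S_k`: some subsequence of `k` entries of `σ` is in the
same relative order as `τ`. -/
def Contains {n k : ℕ} (σ : Equiv.Perm (Fin n)) (τ : Equiv.Perm (Fin k)) : Prop :=
  ∃ f : Fin k → Fin n, StrictMono f ∧ ∀ a b : Fin k, σ (f a) < σ (f b) ↔ τ a < τ b

/-- `S_n(T)`: the permutations in `S_n` that avoid every pattern in `T`. -/
def avoiders (n : ℕ) {k : ℕ} (T : Set (Equiv.Perm (Fin k))) : Set (Equiv.Perm (Fin n)) :=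
  {σ | ∀ τ ∈ T, ¬ Contains σ τ}

/-- The uniform probability measure on `S_n(T)`, as a measure on `S_n`. -/
noncomputable def unif (n : ℕ) {k : ℕ} (T : Set (Equiv.Perm (Fin k))) :
    Measure (Equiv.Perm (Fin n)) :=
  uniformOn (avoiders n T)

/-- The positions `f 0 < f 1 < ⋯ < f (k-1)` carry an alternating subsequence of `σ` of length `k`:
`σ (f 0) > σ (f 1) < σ (f 2) > σ (f 3) < ⋯`. -/
def IsAlternating {n k : ℕ} (σ : Equiv.Perm (Fin n)) (f : Fin k → Fin n) : Prop :=
  StrictMono f ∧ ∀ (i : ℕ) (h : i + 1 < k),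
    (Even i → σ (f ⟨i + 1, h⟩) < σ (f ⟨i, Nat.lt_of_succ_lt h⟩)) ∧
    (Odd i → σ (f ⟨i, Nat.lt_of_succ_lt h⟩) < σ (f ⟨i + 1, h⟩))

/-- `LAS_n(σ)`: the length of the longest alternating subsequence of `σ`. -/
noncomputable def LAS {n : ℕ} (σ : Equiv.Perm (Fin n)) : ℕ :=
  sSup {k : ℕ | ∃ f : Fin k → Fin n, IsAlternating σ f}

/-- The supremum defining `LAS σ` is attained: it is a maximum. -/
theorem isGreatest_LAS {n : ℕ} (σ : Equiv.Perm (Fin n)) :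
    IsGreatest {k : ℕ | ∃ f : Fin k → Fin n, IsAlternating σ f} (LAS σ) := by
  have hb : BddAbove {k : ℕ | ∃ f : Fin k → Fin n, IsAlternating σ f} := by
    refine ⟨n, ?_⟩
    rintro k ⟨f, hf, -⟩
    simpa using Fintype.card_le_of_injective f hf.injective
  have hne : {k : ℕ | ∃ f : Fin k → Fin n, IsAlternating σ f}.Nonempty :=
    ⟨0, Fin.elim0, fun a => a.elim0, fun i h => absurd h (Nat.not_lt_zero _)⟩
  exact ⟨Nat.sSup_mem hne hb, fun k hk => le_csSup hb hk⟩

/-- The mean of `LAS_n` on `S_n(T)` under the uniform probability measure. -/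
noncomputable def meanLAS (n : ℕ) {k : ℕ} (T : Set (Equiv.Perm (Fin k))) : ℝ :=
  ∫ σ : Equiv.Perm (Fin n), (LAS σ : ℝ) ∂(unif n T)

/-- The standard deviation of `LAS_n` on `S_n(T)` under the uniform probability measure. -/
noncomputable def sdLAS (n : ℕ) {k : ℕ} (T : Set (Equiv.Perm (Fin k))) : ℝ :=
  Real.sqrt (variance (fun σ : Equiv.Perm (Fin n) => (LAS σ : ℝ)) (unif n T))

/-- `LAS_n` on `S_n(T)` is asymptotically normal: the distribution functions of
`(LAS_n - mean) / (standard deviation)` converge pointwise to that of the standard normal law. -/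
def AsympNormalLAS {k : ℕ} (T : Set (Equiv.Perm (Fin k))) : Prop :=
  ∀ t : ℝ, Tendsto
    (fun n : ℕ => (unif n T).real
      {σ : Equiv.Perm (Fin n) | ((LAS σ : ℝ) - meanLAS n T) / sdLAS n T ≤ t})
    atTop (𝓝 (cdf (gaussianReal 0 1) t))

/-- `a_n ∼ b_n`, that is, `a_n / b_n → 1`. -/
def AsympEq (a b : ℕ → ℝ) : Prop :=
  Tendsto (fun n => a n / b n) atTop (𝓝 1)

/-! The patterns of length three, in one-line notation. Values and positions are counted from `0`,
so that for instance `132` is the map `0 ↦ 0, 1 ↦ 2, 2 ↦ 1`. -/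

def p123 : Equiv.Perm (Fin 3) := ⟨![0, 1, 2], ![0, 1, 2], by decide, by decide⟩
def p132 : Equiv.Perm (Fin 3) := ⟨![0, 2, 1], ![0, 2, 1], by decide, by decide⟩
def p213 : Equiv.Perm (Fin 3) := ⟨![1, 0, 2], ![1, 0, 2], by decide, by decide⟩
def p231 : Equiv.Perm (Fin 3) := ⟨![1, 2, 0], ![2, 0, 1], by decide, by decide⟩
def p312 : Equiv.Perm (Fin 3) := ⟨![2, 0, 1], ![1, 2, 0], by decide, by decide⟩
def p321 : Equiv.Perm (Fin 3) := ⟨![2, 1, 0], ![2, 1, 0], by decide, by decide⟩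

end PermPattern

/-!
For `{132, 321}` and `{132, 231}`: in an alternating subsequence `a > b < c > d` of length four, the
entries `b, c, d` form a `132` unless `d < b`, and then `a, b, d` form a `321` and `b, c, d` form
a `231`.

For the other three pairs, `S_{m+1}(T)` has `2 ^ m` elements and the uniform permutation can be
generated by `m` fair coin tosses so that `LAS` is the number of heads up to a bounded error. Always
`LAS σ = 1 + (number of turns)`, where a turn is a change in the descent word of `σ`, an initial
descent being counted too (`LAS_eq_numTurns_add_one`).

* If `T = {132, 312}`, every entry is larger than all or smaller than all of its predecessors; if
  `T = {132, 213}`, the permutation is a sequence of increasing blocks of consecutive values, each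
  block below the one before it. In both cases the descent word determines the permutation and is
  arbitrary (`bijOn_descentWord_p132_p312`, `bijOn_descentWord_p132_p213`). The changes of an
  arbitrary word again form an arbitrary word (`bijective_changeWord`), so `LAS - 1` is exactly
  binomial.
* If `T = {132, 123}`, every entry has at most one larger entry to its right. Let `c` mark the
  entries that have one; it determines the permutation, and it is arbitrary apart from its last
  letter (`bijOn_nonRecordWord`). Ascents are the factors `10` of `c`. They are isolated, so each of
  them brings two turns, as many as the changes of `c` per factor `10`, up to boundary effects
  (`abs_numTrue_changeWord_sub_le`).

The mean and the variance of the number of heads are `m / 2` and `m / 4`. A bounded perturbation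
moves the mean by `O(1)` and the variance by `O(√m)`, and by Slutsky's theorem it does not affect
the limit law given by the central limit theorem (`tendsto_standardized_le`).
-/

namespace PermPattern

/-! ### Patterns of length three -/

theorem contains_fin_three_iff {n : ℕ} {σ : Equiv.Perm (Fin n)} {τ : Equiv.Perm (Fin 3)} :
    Contains σ τ ↔ ∃ i j k : Fin n, i < j ∧ j < k ∧ (σ i < σ j ↔ τ 0 < τ 1) ∧
      (σ i < σ k ↔ τ 0 < τ 2) ∧ (σ j < σ k ↔ τ 1 < τ 2) := by
  constructor
  · rintro ⟨f, hf, h⟩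
    exact ⟨f 0, f 1, f 2, hf (by decide), hf (by decide), h 0 1, h 0 2, h 1 2⟩
  · rintro ⟨i, j, k, hij, hjk, h1, h2, h3⟩
    -- the reversed comparisons follow because both permutations are injective
    have flip : ∀ {a b : Fin n} {c d : Fin 3}, a ≠ b → c ≠ d → (σ a < σ b ↔ τ c < τ d) →
        (σ b < σ a ↔ τ d < τ c) := by
      intro a b c d hab hcd h
      have h₁ := σ.injective.ne hab
      have h₂ := τ.injective.ne hcd
      constructor <;> intro h' <;> by_contra h''
      · exact absurd (h.2 (lt_of_le_of_ne (not_lt.1 h'') h₂)) (lt_asymm h')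
      · exact absurd (h.1 (lt_of_le_of_ne (not_lt.1 h'') h₁)) (lt_asymm h')
    refine ⟨![i, j, k], ?_, ?_⟩
    · rw [Fin.strictMono_iff_lt_succ]
      intro a
      fin_cases a
      · exact hij
      · exact hjk
    · intro a b
      fin_cases a <;> fin_cases b
      · simp
      · exact h1
      · exact h2
      · exact flip hij.ne (by decide) h1
      · simp
      · exact h3
      · exact flip (hij.trans hjk).ne (by decide) h2
      · exact flip hjk.ne (by decide) h3
      · simp

section Patterns

variable {n : ℕ} {σ : Equiv.Perm (Fin n)}

theorem contains_p132_iff :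
    Contains σ p132 ↔ ∃ i j k, i < j ∧ j < k ∧ σ i < σ k ∧ σ k < σ j := by
  rw [contains_fin_three_iff]
  refine exists_congr fun i => exists_congr fun j => exists_congr fun k => ?_
  have h1 : p132 0 < p132 1 := by decide
  have h2 : p132 0 < p132 2 := by decide
  have h3 : ¬ p132 1 < p132 2 := by decide
  have : σ j = σ k ↔ j = k := σ.injective.eq_iff
  simp only [h1, h2, h3, iff_true, iff_false]
  grind

theorem contains_p123_iff :
    Contains σ p123 ↔ ∃ i j k, i < j ∧ j < k ∧ σ i < σ j ∧ σ j < σ k := by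
  rw [contains_fin_three_iff]
  refine exists_congr fun i => exists_congr fun j => exists_congr fun k => ?_
  have h1 : p123 0 < p123 1 := by decide
  have h2 : p123 0 < p123 2 := by decide
  have h3 : p123 1 < p123 2 := by decide
  simp only [h1, h2, h3, iff_true]
  grind

theorem contains_p213_iff :
    Contains σ p213 ↔ ∃ i j k, i < j ∧ j < k ∧ σ j < σ i ∧ σ i < σ k := by
  rw [contains_fin_three_iff]
  refine exists_congr fun i => exists_congr fun j => exists_congr fun k => ?_
  have h1 : ¬ p213 0 < p213 1 := by decide
  have h2 : p213 0 < p213 2 := by decide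
  have h3 : p213 1 < p213 2 := by decide
  have : σ i = σ j ↔ i = j := σ.injective.eq_iff
  simp only [h1, h2, h3, iff_true, iff_false]
  grind

theorem contains_p231_iff :
    Contains σ p231 ↔ ∃ i j k, i < j ∧ j < k ∧ σ k < σ i ∧ σ i < σ j := by
  rw [contains_fin_three_iff]
  refine exists_congr fun i => exists_congr fun j => exists_congr fun k => ?_
  have h1 : p231 0 < p231 1 := by decide
  have h2 : ¬ p231 0 < p231 2 := by decide
  have h3 : ¬ p231 1 < p231 2 := by decide
  have : σ i = σ k ↔ i = k := σ.injective.eq_iff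
  simp only [h1, h2, h3, iff_true, iff_false]
  grind

theorem contains_p312_iff :
    Contains σ p312 ↔ ∃ i j k, i < j ∧ j < k ∧ σ j < σ k ∧ σ k < σ i := by
  rw [contains_fin_three_iff]
  refine exists_congr fun i => exists_congr fun j => exists_congr fun k => ?_
  have h1 : ¬ p312 0 < p312 1 := by decide
  have h2 : ¬ p312 0 < p312 2 := by decide
  have h3 : p312 1 < p312 2 := by decide
  have : σ i = σ k ↔ i = k := σ.injective.eq_iff
  simp only [h1, h2, h3, iff_true, iff_false]
  grind

theorem contains_p321_iff :
    Contains σ p321 ↔ ∃ i j k, i < j ∧ j < k ∧ σ k < σ j ∧ σ j < σ i := by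
  rw [contains_fin_three_iff]
  refine exists_congr fun i => exists_congr fun j => exists_congr fun k => ?_
  have h1 : ¬ p321 0 < p321 1 := by decide
  have h2 : ¬ p321 0 < p321 2 := by decide
  have h3 : ¬ p321 1 < p321 2 := by decide
  have : σ i = σ j ↔ i = j := σ.injective.eq_iff
  have : σ j = σ k ↔ j = k := σ.injective.eq_iff
  simp only [h1, h2, h3, iff_false]
  grind

theorem mem_avoiders_pair {k : ℕ} {τ₁ τ₂ : Equiv.Perm (Fin k)} :
    σ ∈ avoiders n {τ₁, τ₂} ↔ ¬ Contains σ τ₁ ∧ ¬ Contains σ τ₂ := by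
  simp [avoiders]

/-! ### Pairs of patterns with bounded alternating subsequences -/

/-- An alternating subsequence of length four has the shape `σ a > σ b < σ c > σ d`. -/
theorem LAS_le_three_of_forall
    (h : ∀ a b c d, a < b → b < c → c < d → σ b < σ a → σ b < σ c → σ d < σ c → False) :
    LAS σ ≤ 3 := by
  obtain ⟨f, hf, hs⟩ := (isGreatest_LAS σ).1
  by_contra! hk
  exact h (f ⟨0, by omega⟩) (f ⟨1, by omega⟩) (f ⟨2, by omega⟩) (f ⟨3, by omega⟩)
    (hf (by simp)) (hf (by simp)) (hf (by simp))
    ((hs 0 (by omega)).1 (by decide)) ((hs 1 (by omega)).2 (by decide))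
    ((hs 2 (by omega)).1 (by decide))

theorem LAS_le_three_of_mem_avoiders_p132_p321 (hσ : σ ∈ avoiders n {p132, p321}) :
    LAS σ ≤ 3 := by
  rw [mem_avoiders_pair, contains_p132_iff, contains_p321_iff] at hσ
  refine LAS_le_three_of_forall fun a b c d hab hbc hcd h1 h2 h3 => ?_
  rcases lt_trichotomy (σ b) (σ d) with h | h | h
  · exact hσ.1 ⟨b, c, d, hbc, hcd, h, h3⟩
  · exact (hbc.trans hcd).ne (σ.injective h)
  · exact hσ.2 ⟨a, b, d, hab, hbc.trans hcd, h, h1⟩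

theorem LAS_le_three_of_mem_avoiders_p132_p231 (hσ : σ ∈ avoiders n {p132, p231}) :
    LAS σ ≤ 3 := by
  rw [mem_avoiders_pair, contains_p132_iff, contains_p231_iff] at hσ
  refine LAS_le_three_of_forall fun a b c d hab hbc hcd h1 h2 h3 => ?_
  rcases lt_trichotomy (σ b) (σ d) with h | h | h
  · exact hσ.1 ⟨b, c, d, hbc, hcd, h, h3⟩
  · exact (hbc.trans hcd).ne (σ.injective h)
  · exact hσ.2 ⟨b, c, d, hbc, hcd, h, h2⟩

end Patterns

/-! ### Binary words -/

/-- The number of letters `true` among the first `t` letters of an infinite binary word. -/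
def numTrue (W : ℕ → Bool) (t : ℕ) : ℕ := ∑ i ∈ Finset.range t, (W i).toNat

/-- The word marking the positions at which `W` differs from its predecessor, where `W` is thought
of as preceded by the letter `false`. -/
def changeWord (W : ℕ → Bool) : ℕ → Bool
  | 0 => W 0
  | i + 1 => xor (W (i + 1)) (W i)

/-- Extension of a finite binary word by the letter `false`. -/
def extend {m : ℕ} (w : Fin m → Bool) (i : ℕ) : Bool := if h : i < m then w ⟨i, h⟩ else false

/-- The descent word of a permutation: the letter `true` marks the descents. -/
def descentWord {m : ℕ} (σ : Equiv.Perm (Fin (m + 1))) (i : Fin m) : Bool :=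
  decide (σ i.succ < σ i.castSucc)

theorem numTrue_zero (W : ℕ → Bool) : numTrue W 0 = 0 := rfl

theorem numTrue_succ (W : ℕ → Bool) (t : ℕ) : numTrue W (t + 1) = numTrue W t + (W t).toNat :=
  Finset.sum_range_succ _ _

theorem numTrue_eq_of_eq {W W' : ℕ → Bool} {t : ℕ} (h : ∀ i < t, W i = W' i) :
    numTrue W t = numTrue W' t :=
  Finset.sum_congr rfl fun i hi => by rw [h i (Finset.mem_range.1 hi)]

theorem numTrue_mono (W : ℕ → Bool) : Monotone (numTrue W) :=
  monotone_nat_of_le_succ fun t => by rw [numTrue_succ]; exact Nat.le_add_right _ _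

theorem numTrue_succ_le (W : ℕ → Bool) (t : ℕ) : numTrue W (t + 1) ≤ numTrue W t + 1 := by
  rw [numTrue_succ]
  exact Nat.add_le_add_left (Bool.toNat_le _) _

theorem extend_of_lt {m : ℕ} (w : Fin m → Bool) {i : ℕ} (h : i < m) : extend w i = w ⟨i, h⟩ :=
  dif_pos h

theorem extend_of_le {m : ℕ} (w : Fin m → Bool) {i : ℕ} (h : m ≤ i) : extend w i = false :=
  dif_neg (not_lt.2 h)

theorem extend_val {m : ℕ} (w : Fin m → Bool) (i : Fin m) : extend w i = w i := dif_pos i.2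

/-- The letters of a word are recovered from the parities of its numbers of changes. -/
theorem odd_numTrue_changeWord_succ (W : ℕ → Bool) (t : ℕ) :
    Odd (numTrue (changeWord W) (t + 1)) ↔ W t = true := by
  induction t with
  | zero => cases h : W 0 <;> simp [numTrue, changeWord, h]
  | succ t ih =>
    rw [numTrue_succ, Nat.odd_add, ih]
    cases h : W t <;> cases h' : W (t + 1) <;> simp [changeWord, h, h']

/-! ### The longest alternating subsequence counts the turns -/

section LongestAlternating

variable {m : ℕ} (σ : Equiv.Perm (Fin (m + 1)))

theorem extend_descentWord {i : ℕ} (hi : i < m) :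
    extend (descentWord σ) i = true ↔
      σ ⟨i + 1, Nat.succ_lt_succ hi⟩ < σ ⟨i, hi.trans (Nat.lt_succ_self m)⟩ := by
  rw [extend_of_lt _ hi, descentWord, decide_eq_true_iff]
  rfl

/-- The number of changes of direction of `σ` before position `t`; an initial descent counts as
a change. -/
def numTurns (t : ℕ) : ℕ := numTrue (changeWord (extend (descentWord σ))) t

theorem numTurns_mono : Monotone (numTurns σ) := numTrue_mono _

/-- Between two positions with no turn after the first step, `σ` is monotone, and the direction is
given by the parity of the number of turns. -/
theorem compare_of_numTurns_eq {p q : ℕ} (hpq : p < q) (hq : q < m + 1)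
    (h : numTurns σ (p + 1) = numTurns σ q) :
    (Odd (numTurns σ q) → σ ⟨q, hq⟩ < σ ⟨p, hpq.trans hq⟩) ∧
      (Even (numTurns σ q) → σ ⟨p, hpq.trans hq⟩ < σ ⟨q, hq⟩) := by
  induction q, hpq using Nat.le_induction with
  | base =>
    have hd := extend_descentWord σ (show p < m by omega)
    rw [← odd_numTrue_changeWord_succ] at hd
    refine ⟨fun ho => hd.1 ho, fun he => ?_⟩
    refine lt_of_le_of_ne (not_lt.1 fun hlt => Nat.not_odd_iff_even.2 he (hd.2 hlt)) ?_
    exact σ.injective.ne (by simp)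
  | succ q hpq ih =>
    have h1 : numTurns σ (p + 1) = numTurns σ q :=
      le_antisymm (numTurns_mono σ hpq) (h ▸ numTurns_mono σ (Nat.le_succ q))
    have h2 : numTurns σ (q + 1) = numTurns σ q := h.symm.trans h1
    obtain ⟨ih1, ih2⟩ := ih (by omega) h1
    have hd := extend_descentWord σ (show q < m by omega)
    rw [← odd_numTrue_changeWord_succ] at hd
    refine ⟨fun ho => (hd.1 ho).trans (ih1 (h2 ▸ ho)), fun he => (ih2 (h2 ▸ he)).trans ?_⟩
    refine lt_of_le_of_ne (not_lt.1 fun hlt => Nat.not_odd_iff_even.2 he (hd.2 hlt)) ?_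
    exact σ.injective.ne (by simp)

/-- The `j`-th entry of an alternating subsequence is preceded by at least `j` turns. -/
theorem IsAlternating.le_numTurns {k : ℕ} {f : Fin k → Fin (m + 1)} (hf : IsAlternating σ f)
    (j : ℕ) (hj : j < k) : j ≤ numTurns σ (f ⟨j, hj⟩) := by
  induction j with
  | zero => exact Nat.zero_le _
  | succ j ih =>
    have hj' := Nat.lt_of_succ_lt hj
    have hlt : f ⟨j, hj'⟩ < f ⟨j + 1, hj⟩ := hf.1 (by simp)
    have hmono : numTurns σ (f ⟨j, hj'⟩) ≤ numTurns σ (f ⟨j, hj'⟩ + 1) :=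
      numTurns_mono σ (Nat.le_succ _)
    have hmono' : numTurns σ (f ⟨j, hj'⟩ + 1) ≤ numTurns σ (f ⟨j + 1, hj⟩) :=
      numTurns_mono σ hlt
    have ih := ih hj'
    by_contra! hcon
    have hj_eq : numTurns σ (f ⟨j + 1, hj⟩) = j := by omega
    obtain ⟨h1, h2⟩ := compare_of_numTurns_eq σ hlt (f ⟨j + 1, hj⟩).2 (by omega)
    rw [hj_eq] at h1 h2
    rcases Nat.even_or_odd j with he | ho
    · exact lt_asymm (h2 he) ((hf.2 j hj).1 he)
    · exact lt_asymm (h1 ho) ((hf.2 j hj).2 ho)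

/-- The last position preceded by at most `j` turns. -/
def turn (j : ℕ) : ℕ := Nat.findGreatest (fun t => numTurns σ t ≤ j) m

theorem turn_le (j : ℕ) : turn σ j ≤ m := Nat.findGreatest_le _

theorem numTurns_turn {j : ℕ} (hj : j ≤ numTurns σ m) : numTurns σ (turn σ j) = j := by
  have hle : numTurns σ (turn σ j) ≤ j :=
    Nat.findGreatest_spec (P := fun t => numTurns σ t ≤ j) (Nat.zero_le m) (Nat.zero_le j)
  rcases (turn_le σ j).eq_or_lt with h | h
  · rw [h] at hle ⊢
    exact le_antisymm hle hj
  · have h1 : ¬ numTurns σ (turn σ j + 1) ≤ j :=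
      Nat.findGreatest_is_greatest (P := fun t => numTurns σ t ≤ j) (k := turn σ j + 1)
        (Nat.lt_succ_self _) h
    have h2 : numTurns σ (turn σ j + 1) ≤ numTurns σ (turn σ j) + 1 := numTrue_succ_le _ _
    omega

theorem turn_lt_turn_succ {j : ℕ} (hj : j + 1 ≤ numTurns σ m) :
    turn σ j < turn σ (j + 1) := by
  by_contra! h
  have := numTurns_mono σ h
  rw [numTurns_turn σ hj, numTurns_turn σ (by omega)] at this
  omega

theorem numTurns_turn_succ {j : ℕ} (hj : j + 1 ≤ numTurns σ m) :
    numTurns σ (turn σ j + 1) = numTurns σ (turn σ (j + 1)) := by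
  have hlt := turn_lt_turn_succ σ hj
  have h1 : ¬ numTurns σ (turn σ j + 1) ≤ j :=
    Nat.findGreatest_is_greatest (P := fun t => numTurns σ t ≤ j) (k := turn σ j + 1)
      (Nat.lt_succ_self _) (hlt.trans_le (turn_le σ _))
  have h2 := numTurns_mono σ (Nat.succ_le_of_lt hlt)
  rw [Nat.succ_eq_add_one, numTurns_turn σ hj] at h2
  rw [numTurns_turn σ hj]
  omega

/-- The positions preceding the turns, followed by the last position, carry an alternating
subsequence. -/
theorem isAlternating_turn :
    IsAlternating σ fun j : Fin (numTurns σ m + 1) =>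
      (⟨turn σ j, Nat.lt_succ_of_le (turn_le σ j)⟩ : Fin (m + 1)) := by
  refine ⟨Fin.strictMono_iff_lt_succ.2 fun j => turn_lt_turn_succ σ j.2, fun j hj => ?_⟩
  have hj' : j + 1 ≤ numTurns σ m := by omega
  have h := compare_of_numTurns_eq σ (turn_lt_turn_succ σ hj')
    (Nat.lt_succ_of_le (turn_le σ (j + 1))) (numTurns_turn_succ σ hj')
  rw [numTurns_turn σ hj'] at h
  exact ⟨fun he => h.1 he.add_one, fun ho => h.2 ho.add_one⟩

theorem LAS_eq_numTurns_add_one : LAS σ = numTurns σ m + 1 := by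
  refine le_antisymm ?_ ((isGreatest_LAS σ).2 ⟨_, isAlternating_turn σ⟩)
  obtain ⟨f, hf⟩ := (isGreatest_LAS σ).1
  rcases Nat.eq_zero_or_pos (LAS σ) with h | h
  · omega
  · have h1 := hf.le_numTurns σ (LAS σ - 1) (by omega)
    have h2 := numTurns_mono σ (Nat.le_of_lt_succ (f ⟨LAS σ - 1, by omega⟩).2)
    omega

end LongestAlternating

/-! ### Permutations with a prescribed relative order -/

/-- Every injective integer sequence has the relative order of a permutation. -/
theorem exists_perm_lt_iff {n : ℕ} {g : Fin n → ℤ} (hg : Function.Injective g) :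
    ∃ σ : Equiv.Perm (Fin n), ∀ i j, σ i < σ j ↔ g i < g j := by
  have h : StrictMono (g ∘ Tuple.sort g) :=
    (Tuple.monotone_sort g).strictMono_of_injective (hg.comp (Tuple.sort g).injective)
  refine ⟨(Tuple.sort g).symm, fun i j => ?_⟩
  rw [← h.lt_iff_lt]
  simp

theorem injective_of_ne_of_lt {n : ℕ} {g : Fin n → ℤ} (h : ∀ i j, i < j → g i ≠ g j) :
    Function.Injective g := fun i j he => by
  rcases lt_trichotomy i j with hij | hij | hij
  · exact absurd he (h i j hij)
  · exact hij
  · exact absurd he.symm (h j i hij)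

theorem perm_eq_of_lt_iff {n : ℕ} {σ τ : Equiv.Perm (Fin n)}
    (h : ∀ i j, i < j → (σ i < σ j ↔ τ i < τ j)) : σ = τ := by
  have key : ∀ i j, σ i < σ j ↔ τ i < τ j := by
    intro i j
    rcases lt_trichotomy i j with hij | rfl | hij
    · exact h i j hij
    · simp
    · have := h j i hij
      have h1 := σ.injective.ne hij.ne
      have h2 := τ.injective.ne hij.ne
      rw [← not_le, ← not_le, (lt_iff_le_and_ne.trans (and_iff_left h1)).symm.trans
        (this.trans (lt_iff_le_and_ne.trans (and_iff_left h2)))]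
  have hmono : StrictMono (fun x => τ (σ.symm x)) := fun x y hxy =>
    (key _ _).1 (by simpa using hxy)
  have hid : (fun x => τ (σ.symm x)) = id :=
    funext fun x => by
      have := Subsingleton.elim (hmono.orderIsoOfSurjective _
        (τ.surjective.comp σ.symm.surjective)) (OrderIso.refl _)
      exact DFunLike.congr_fun this x
  ext1 i
  have := congrFun hid (σ i)
  simpa using this.symm

variable {m : ℕ}

/-! ### Coding by descents -/

theorem descentWord_eq_true {σ : Equiv.Perm (Fin (m + 1))} {i : Fin m} :
    descentWord σ i = true ↔ σ i.succ < σ i.castSucc := decide_eq_true_iff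

theorem descentWord_eq_false {σ : Equiv.Perm (Fin (m + 1))} {i : Fin m} :
    descentWord σ i = false ↔ σ i.castSucc < σ i.succ := by
  rw [descentWord, decide_eq_false_iff_not, not_lt]
  exact ⟨fun h => lt_of_le_of_ne h (σ.injective.ne Fin.castSucc_lt_succ.ne), le_of_lt⟩

/-- Avoiding `132` and `312` means that every entry is a record, from above or from below. -/
theorem lt_iff_of_mem_avoiders_p132_p312 {σ : Equiv.Perm (Fin (m + 1))}
    (hσ : σ ∈ avoiders (m + 1) {p132, p312}) {i : Fin (m + 1)} {j : Fin m}
    (hij : i < j.succ) : σ i < σ j.succ ↔ descentWord σ j = false := by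
  rw [mem_avoiders_pair, contains_p132_iff, contains_p312_iff] at hσ
  rw [descentWord_eq_false]
  rcases (Fin.le_castSucc_iff.2 hij).eq_or_lt with rfl | h
  · rfl
  have hs : j.castSucc < j.succ := Fin.castSucc_lt_succ
  have h1 : σ i ≠ σ j.succ := σ.injective.ne hij.ne
  have h2 : σ j.castSucc ≠ σ j.succ := σ.injective.ne hs.ne
  constructor <;> intro hlt <;> by_contra hcon
  · exact hσ.1 ⟨i, j.castSucc, j.succ, h, hs, hlt, lt_of_le_of_ne (not_lt.1 hcon) h2.symm⟩
  · exact hσ.2 ⟨i, j.castSucc, j.succ, h, hs, hlt, lt_of_le_of_ne (not_lt.1 hcon) h1.symm⟩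

theorem bijOn_descentWord_p132_p312 (m : ℕ) :
    Set.BijOn descentWord (avoiders (m + 1) {p132, p312}) Set.univ := by
  refine ⟨Set.mapsTo_univ _ _, fun σ hσ τ hτ h => perm_eq_of_lt_iff fun i j hij => ?_, ?_⟩
  · obtain ⟨j, rfl⟩ := Fin.exists_succ_eq.2 (Fin.ne_zero_of_lt hij)
    rw [lt_iff_of_mem_avoiders_p132_p312 hσ hij, lt_iff_of_mem_avoiders_p132_p312 hτ hij, h]
  · rintro w -
    -- the `i`-th entry beats all earlier ones in absolute value, and the letters give the signs
    set g : Fin (m + 1) → ℤ := Fin.cases 0 fun i => if w i then -(i + 1) else i + 1 with hg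
    have habs : ∀ i, g i = i ∨ g i = -i := by
      intro i
      cases i using Fin.cases with
      | zero => simp [hg]
      | succ i => by_cases h : w i <;> simp [hg, h]
    have hinj : Function.Injective g := fun i j hij => by
      have h1 := habs i
      have h2 := habs j
      ext
      omega
    obtain ⟨σ, hσ⟩ := exists_perm_lt_iff hinj
    refine ⟨σ, ?_, funext fun i => ?_⟩
    · rw [mem_avoiders_pair, contains_p132_iff, contains_p312_iff]
      simp only [hσ]
      constructor <;> rintro ⟨i, j, k, hij, hjk, h1, h2⟩ <;>
        · have h3 := habs i
          have h4 := habs j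
          have h5 := habs k
          omega
    · rw [Bool.eq_iff_iff, descentWord_eq_true, hσ]
      have h := habs i.castSucc
      have hs : g i.succ = if w i then -(i + 1 : ℤ) else i + 1 := rfl
      rw [Fin.val_castSucc] at h
      cases hw : w i <;> rw [hw] at hs <;>
        simp only [reduceCtorEq, if_true, if_false, iff_true, iff_false] at hs ⊢ <;> omega

/-- In a permutation avoiding `132` and `213`, two entries are in increasing order exactly when no
descent separates them. -/
theorem lt_iff_of_mem_avoiders_p132_p213 {σ : Equiv.Perm (Fin (m + 1))}
    (hσ : σ ∈ avoiders (m + 1) {p132, p213}) {i j : Fin (m + 1)} (hij : i < j) :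
    σ i < σ j ↔ ∀ k : Fin m, i ≤ k.castSucc → k.succ ≤ j → descentWord σ k = false := by
  rw [mem_avoiders_pair, contains_p132_iff, contains_p213_iff] at hσ
  simp only [not_exists, not_and] at hσ
  obtain ⟨h132, h213⟩ := hσ
  constructor
  · intro hlt k hik hkj
    by_contra hk
    have hk : σ k.succ < σ k.castSucc := by simpa [descentWord] using hk
    have hs : k.castSucc < k.succ := Fin.castSucc_lt_succ
    have e1 : σ i = σ k.castSucc ↔ i = k.castSucc := σ.injective.eq_iff
    have e2 : σ i = σ k.succ ↔ i = k.succ := σ.injective.eq_iff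
    have e3 : σ k.succ = σ j ↔ k.succ = j := σ.injective.eq_iff
    -- whichever way the descent is placed between `σ i < σ j`, a forbidden pattern arises
    rcases lt_or_ge (σ k.succ) (σ i) with h | h
    · have hne : k.succ ≠ j := by rintro rfl; exact lt_asymm h hlt
      exact h213 i k.succ j (hik.trans_lt hs) (lt_of_le_of_ne hkj hne) h hlt
    · have hne : i ≠ k.castSucc := by rintro rfl; exact absurd hk (not_lt.2 h)
      exact h132 i k.castSucc k.succ (lt_of_le_of_ne hik hne) hs
        (lt_of_le_of_ne h fun he => (hik.trans_lt hs).ne (e2.1 he)) hk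
  · intro h
    have key : ∀ q (hq : q < m + 1), (i : ℕ) < q → q ≤ j → σ i < σ ⟨q, hq⟩ := by
      intro q hq hiq
      induction q, hiq using Nat.le_induction with
      | base =>
        intro hj
        exact descentWord_eq_false.1 (h ⟨i, by omega⟩ (le_refl _) hj)
      | succ q hiq ih =>
        intro hj
        refine (ih (by omega) (by omega)).trans ?_
        exact descentWord_eq_false.1 (h ⟨q, by omega⟩ (show (i : ℕ) ≤ q by omega) hj)
    exact key j j.2 hij le_rfl

/-- Blocks of increasing consecutive values, each block below its predecessor; `numTrue W i` is
the number of the block containing position `i`. -/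
theorem block_lt_iff {N : ℕ} (W : ℕ → Bool) {i j : ℕ} (hij : i < j) (hj : j < N) :
    (i : ℤ) - N * numTrue W i < j - N * numTrue W j ↔ numTrue W i = numTrue W j := by
  constructor
  · intro h
    by_contra hne
    have : numTrue W i + 1 ≤ numTrue W j := lt_of_le_of_ne (numTrue_mono W hij.le) hne
    have : (N : ℤ) * (numTrue W i + 1) ≤ N * numTrue W j := by
      exact_mod_cast Nat.mul_le_mul_left N this
    linarith [show (j : ℤ) < N by exact_mod_cast hj, show (0 : ℤ) ≤ i by positivity]
  · intro h
    rw [h]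
    linarith [show (i : ℤ) < j by exact_mod_cast hij]

theorem bijOn_descentWord_p132_p213 (m : ℕ) :
    Set.BijOn descentWord (avoiders (m + 1) {p132, p213}) Set.univ := by
  refine ⟨Set.mapsTo_univ _ _, fun σ hσ τ hτ h => perm_eq_of_lt_iff fun i j hij => ?_, ?_⟩
  · rw [lt_iff_of_mem_avoiders_p132_p213 hσ hij, lt_iff_of_mem_avoiders_p132_p213 hτ hij, h]
  · rintro w -
    set W := extend w
    set g : Fin (m + 1) → ℤ := fun i => i - (m + 1 : ℕ) * numTrue W i with hg
    have hlt : ∀ i j : Fin (m + 1), i < j → (g i < g j ↔ numTrue W i = numTrue W j) :=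
      fun i j hij => block_lt_iff W hij j.2
    have hinj : Function.Injective g := injective_of_ne_of_lt fun i j hij he => by
      have h1 : ¬ numTrue W i = numTrue W j := fun h => ((hlt i j hij).2 h).ne he
      have h2 : (m + 1 : ℕ) * ((numTrue W j : ℤ) - numTrue W i) = j - i := by
        simp only [hg] at he
        linarith
      have h3 : numTrue W i + 1 ≤ numTrue W j := lt_of_le_of_ne (numTrue_mono W hij.le) h1
      have h4 : (1 : ℤ) ≤ (numTrue W j : ℤ) - numTrue W i := by omega
      have h5 := mul_le_mul_of_nonneg_left h4 (show (0 : ℤ) ≤ (m + 1 : ℕ) by positivity)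
      omega
    obtain ⟨σ, hσ⟩ := exists_perm_lt_iff hinj
    have hmono : ∀ i j : Fin (m + 1), i < j → numTrue W i ≤ numTrue W j :=
      fun i j hij => numTrue_mono W hij.le
    refine ⟨σ, ?_, funext fun i => ?_⟩
    · rw [mem_avoiders_pair, contains_p132_iff, contains_p213_iff]
      simp only [hσ]
      constructor <;> rintro ⟨i, j, k, hij, hjk, h1, h2⟩
      · have := (hlt i k (hij.trans hjk)).1 h1
        have := (hlt j k hjk).2 (by have := hmono i j hij; have := hmono j k hjk; omega)
        exact lt_asymm this h2
      · have := (hlt i k (hij.trans hjk)).1 h2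
        have := (hlt i j hij).2 (by have := hmono i j hij; have := hmono j k hjk; omega)
        exact lt_asymm this h1
    · have h := hlt i.castSucc i.succ Fin.castSucc_lt_succ
      rw [Fin.val_succ, numTrue_succ, Fin.val_castSucc, show W i = w i from extend_val w i] at h
      rw [← Bool.not_inj_iff, Bool.eq_iff_iff, Bool.not_eq_true', Bool.not_eq_true',
        descentWord_eq_false, hσ, h]
      cases w i <;> simp

/-- The change word is a bijective recoding of finite binary words. -/
theorem bijective_changeWord (m : ℕ) :
    Function.Bijective fun (w : Fin m → Bool) (i : Fin m) => changeWord (extend w) i := by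
  refine Finite.injective_iff_bijective.1 fun w w' h => ?_
  have key : ∀ i < m, extend w i = extend w' i := by
    intro i
    induction i with
    | zero => exact fun hi => congrFun h ⟨0, hi⟩
    | succ i ih =>
      intro hi
      have h1 := congrFun h ⟨i + 1, hi⟩
      simp only [changeWord, ih (by omega)] at h1
      exact Bool.xor_left_inj.1 h1
  funext i
  rw [← extend_val w, ← extend_val w', key i i.2]

theorem LAS_eq_sum_changeWord (σ : Equiv.Perm (Fin (m + 1))) :
    LAS σ = ∑ i : Fin m, (changeWord (extend (descentWord σ)) i).toNat + 1 := by
  rw [LAS_eq_numTurns_add_one, numTurns, numTrue, Finset.sum_range]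

/-! ### Coding by the entries that are not right-to-left maxima -/

/-- The word marking the entries that have a larger entry to their right (the last entry, which
never has one, is left out). -/
noncomputable def nonRecordWord (σ : Equiv.Perm (Fin (m + 1))) (i : Fin m) : Bool :=
  open Classical in decide (∃ l, i.castSucc < l ∧ σ i.castSucc < σ l)

theorem extend_nonRecordWord (σ : Equiv.Perm (Fin (m + 1))) (i : Fin (m + 1)) :
    extend (nonRecordWord σ) i = true ↔ ∃ l, i < l ∧ σ i < σ l := by
  cases i using Fin.lastCases with
  | last =>
    rw [extend_of_le _ (by simp)]
    simp only [Bool.false_eq_true, false_iff, not_exists, not_and]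
    exact fun l hl => absurd (Fin.le_last l) (not_le.2 hl)
  | cast i => rw [Fin.val_castSucc, extend_val, nonRecordWord, decide_eq_true_iff]

/-- In a permutation avoiding `132` and `123` every entry has at most one larger entry to its right,
and that entry is the next right-to-left maximum. -/
theorem lt_iff_of_mem_avoiders_p132_p123 {σ : Equiv.Perm (Fin (m + 1))}
    (hσ : σ ∈ avoiders (m + 1) {p132, p123}) {i j : Fin (m + 1)} (hij : i < j) :
    σ i < σ j ↔ (∀ k : Fin (m + 1), i ≤ k → k < j → extend (nonRecordWord σ) k = true) ∧
      extend (nonRecordWord σ) j = false := by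
  rw [mem_avoiders_pair, contains_p132_iff, contains_p123_iff] at hσ
  have huniq : ∀ i j k, i < j → j < k → σ i < σ j → σ i < σ k → False := by
    intro i j k h1 h2 h3 h4
    rcases lt_trichotomy (σ j) (σ k) with h | h | h
    · exact hσ.2 ⟨i, j, k, h1, h2, h3, h⟩
    · exact h2.ne (σ.injective h)
    · exact hσ.1 ⟨i, j, k, h1, h2, h4, h⟩
  simp only [← Bool.not_eq_true, extend_nonRecordWord, not_exists, not_and]
  constructor
  · intro h
    refine ⟨fun k hik hkj => ?_, fun l hjl hlt => huniq i j l hij hjl h (h.trans hlt)⟩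
    rcases hik.eq_or_lt with rfl | hik
    · exact ⟨j, hkj, h⟩
    · exact ⟨j, hkj, lt_of_le_of_lt (not_lt.1 fun h' => huniq i k j hik hkj h' h) h⟩
  · rintro ⟨h1, h2⟩
    obtain ⟨l, hil, hl⟩ := h1 i le_rfl hij
    rcases lt_trichotomy l j with h | rfl | h
    · obtain ⟨l', hll, hl'⟩ := h1 l hil.le h
      exact (huniq i l l' hil hll hl (hl.trans hl')).elim
    · exact hl
    · exact hl.trans_le (not_lt.1 (h2 l h))

/-- The infinite word marking the places where `c` differs from its successor. -/
def succChange (c : ℕ → Bool) (i : ℕ) : Bool := xor (c i) (c (i + 1))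

theorem bijective_succChange (m : ℕ) :
    Function.Bijective fun (w : Fin m → Bool) (i : Fin m) => succChange (extend w) i := by
  refine Finite.injective_iff_bijective.1 fun w w' h => ?_
  have key : ∀ d i, m ≤ i + d → extend w i = extend w' i := by
    intro d
    induction d with
    | zero =>
      intro i hi
      rw [extend_of_le _ (show m ≤ i from hi), extend_of_le _ (show m ≤ i from hi)]
    | succ d ih =>
      intro i hi
      rcases le_or_gt m i with hm | hm
      · rw [extend_of_le _ hm, extend_of_le _ hm]
      · have h1 := congrFun h ⟨i, hm⟩
        simp only [succChange, ih (i + 1) (by omega)] at h1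
        exact Bool.xor_left_inj.1 h1
  funext i
  rw [← extend_val w, ← extend_val w', key m i (by omega)]

/-- The values `-N * Z i + (1 or -i)`, with `Z i` the number of letters `false` of `c` before `i`:
each block of positions ends in a letter `false`, decreases up to its last entry, which is its
largest, and lies below the preceding blocks. -/
theorem recordBlock_lt_iff {N : ℕ} (c : ℕ → Bool) {i j : ℕ} (hij : i < j) (hj : j + 1 < N) :
    (if c i then -(i : ℤ) else 1) - N * numTrue (fun k => !c k) i <
      (if c j then -(j : ℤ) else 1) - N * numTrue (fun k => !c k) j ↔
    numTrue (fun k => !c k) i = numTrue (fun k => !c k) j ∧ c j = false := by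
  have hs : numTrue (fun k => !c k) (i + 1) ≤ numTrue (fun k => !c k) j := numTrue_mono _ hij
  rw [numTrue_succ] at hs
  set Zi := numTrue (fun k => !c k) i
  set Zj := numTrue (fun k => !c k) j
  have hNi : (i : ℤ) + 1 < N := by omega
  rcases (show Zi ≤ Zj by omega).eq_or_lt with h | h
  · have hci : c i = true := by
      by_contra hci
      simp [Bool.eq_false_of_not_eq_true hci] at hs
      omega
    rw [h, hci]
    cases c j <;> simp <;> omega
  · have h1 : (N : ℤ) * (Zi + 1) ≤ N * Zj := by exact_mod_cast Nat.mul_le_mul_left N h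
    have h2 : (if c j then -(j : ℤ) else 1) ≤ 1 := by split_ifs <;> omega
    have h3 : -(i : ℤ) ≤ (if c i then -(i : ℤ) else 1) := by split_ifs <;> omega
    constructor
    · intro h
      linarith
    · intro h'
      omega

theorem bijOn_nonRecordWord (m : ℕ) :
    Set.BijOn nonRecordWord (avoiders (m + 1) {p132, p123}) Set.univ := by
  refine ⟨Set.mapsTo_univ _ _, fun σ hσ τ hτ h => perm_eq_of_lt_iff fun i j hij => ?_, ?_⟩
  · rw [lt_iff_of_mem_avoiders_p132_p123 hσ hij, lt_iff_of_mem_avoiders_p132_p123 hτ hij, h]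
  · rintro w -
    set c := extend w with hc
    set Z := numTrue (fun k => !c k) with hZ
    set g : Fin (m + 1) → ℤ :=
      fun i => (if c i then -((i : ℕ) : ℤ) else 1) - (m + 3 : ℕ) * Z i with hg
    have hlt : ∀ i j : Fin (m + 1), i < j → (g i < g j ↔ Z i = Z j ∧ c j = false) :=
      fun i j hij => recordBlock_lt_iff c hij (by omega)
    have hstep : ∀ i j : Fin (m + 1), i < j → Z i + (!c i).toNat ≤ Z j := fun i j hij => by
      have : Z (i + 1) ≤ Z j := numTrue_mono _ hij
      rwa [hZ, numTrue_succ] at this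
    have hinj : Function.Injective g := injective_of_ne_of_lt fun i j hij he => by
      have h1 : ¬ (Z i = Z j ∧ c j = false) := fun h => ((hlt i j hij).2 h).ne he
      have h2 := hstep i j hij
      have hij' : (i : ℤ) < j := by exact_mod_cast hij
      have hjm : (j : ℤ) < m + 1 := by exact_mod_cast j.2
      rcases (show Z i ≤ Z j by omega).eq_or_lt with h | h
      · have hcj : c j = true := by simpa [h] using h1
        have hci : c i = true := by
          by_contra hci
          simp [Bool.eq_false_of_not_eq_true hci] at h2
          omega
        simp only [hg, hci, hcj, if_true, h] at he
        omega
      · have h3 : ((m + 3 : ℕ) : ℤ) * (Z i + 1) ≤ (m + 3 : ℕ) * Z j := by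
          exact_mod_cast Nat.mul_le_mul_left (m + 3) h
        have h4 : (if c j then -((j : ℕ) : ℤ) else 1) ≤ 1 := by split_ifs <;> omega
        have h5 : -((i : ℕ) : ℤ) ≤ (if c i then -((i : ℕ) : ℤ) else 1) := by split_ifs <;> omega
        simp only [hg] at he
        push_cast at h3 he
        linarith
    obtain ⟨σ, hσ⟩ := exists_perm_lt_iff hinj
    have huniq : ∀ i j k : Fin (m + 1), i < j → j < k → g i < g j → g i < g k → False := by
      intro i j k hij hjk h1 h2
      rw [hlt i j hij] at h1
      rw [hlt i k (hij.trans hjk)] at h2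
      have := hstep j k hjk
      simp [h1.2] at this
      omega
    refine ⟨σ, ?_, funext fun i => ?_⟩
    · rw [mem_avoiders_pair, contains_p132_iff, contains_p123_iff]
      simp only [hσ]
      constructor <;> rintro ⟨i, j, k, hij, hjk, h1, h2⟩
      · exact huniq i j k hij hjk (h1.trans h2) h1
      · exact huniq i j k hij hjk h1 (h1.trans h2)
    · rw [Bool.eq_iff_iff, nonRecordWord, decide_eq_true_iff, ← extend_val w]
      simp only [hσ]
      constructor
      · rintro ⟨l, hil, hl⟩
        have h1 := (hlt _ l hil).1 hl
        have h2 := hstep _ l hil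
        by_contra hci
        simp only [Fin.val_castSucc, hc, Bool.eq_false_of_not_eq_true hci, Bool.not_false,
          Bool.toNat_true] at h1 h2
        omega
      · intro hci
        -- the entry at the next letter `false` is larger
        have hex : ∃ l, (i : ℕ) < l ∧ c l = false := ⟨m, i.2, extend_of_le w le_rfl⟩
        classical
        obtain ⟨hil, hcl⟩ := Nat.find_spec hex
        have hlm : Nat.find hex ≤ m := Nat.find_min' hex ⟨i.2, extend_of_le w le_rfl⟩
        refine ⟨⟨Nat.find hex, Nat.lt_succ_of_le hlm⟩, hil, (hlt _ _ hil).2 ⟨?_, hcl⟩⟩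
        have hconst : ∀ q, (i : ℕ) ≤ q → q ≤ Nat.find hex → Z i = Z q := by
          intro q hq
          induction q, hq using Nat.le_induction with
          | base => exact fun _ => rfl
          | succ q hq ih =>
            intro hqf
            rw [ih (by omega), hZ, numTrue_succ]
            have : c q = true := by
              rcases hq.eq_or_lt with rfl | hq'
              · exact hci
              · have := Nat.find_min hex (m := q) (by omega)
                simpa [hq'] using this
            simp [this]
        exact hconst _ hil.le le_rfl

/-- The word `!(c i && !c (i+1))` takes the letter `false` exactly at the factors `10` of `c`. These
are isolated, and between two of them `c` changes twice, so both words change equally often up to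
boundary effects. -/
theorem abs_numTrue_changeWord_sub_le (c : ℕ → Bool) (t : ℕ) :
    |(numTrue (changeWord fun i => !(c i && !c (i + 1))) t : ℤ) - numTrue (succChange c) t| ≤ 2 := by
  cases t with
  | zero => simp [numTrue_zero]
  | succ t =>
    -- the difference is determined by the last two letters, up to a constant in `{-1, 0, 1}`
    have key : |(numTrue (changeWord fun i => !(c i && !c (i + 1))) (t + 1) : ℤ) -
        numTrue (succChange c) (t + 1) - (!c t && !c (t + 1)).toNat| ≤ 1 := by
      induction t with
      | zero => cases h0 : c 0 <;> cases h1 : c 1 <;> simp [numTrue, changeWord, succChange, h0, h1]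
      | succ t ih =>
        rw [numTrue_succ _ (t + 1), numTrue_succ (succChange c) (t + 1)]
        cases h0 : c t <;> cases h1 : c (t + 1) <;> cases h2 : c (t + 1 + 1) <;>
          simp [changeWord, succChange, h0, h1, h2] at ih ⊢ <;> rw [abs_le] at ih ⊢ <;> omega
    have := Bool.toNat_le (!c t && !c (t + 1))
    rw [abs_le] at key ⊢
    omega

/-- For `{132, 123}` the ascents are the factors `10` of the non-record word, so the number of turns
of `σ` and the number of changes of that word differ by at most two. -/
theorem abs_LAS_sub_sum_succChange_le {σ : Equiv.Perm (Fin (m + 1))}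
    (hσ : σ ∈ avoiders (m + 1) {p132, p123}) :
    |(LAS σ : ℝ) - ∑ i : Fin m, ((succChange (extend (nonRecordWord σ)) i).toNat : ℝ)| ≤ 3 := by
  set c := extend (nonRecordWord σ) with hc
  have hW : ∀ i < m, extend (descentWord σ) i = !(c i && !c (i + 1)) := by
    intro i hi
    rw [← Bool.not_inj_iff, Bool.eq_iff_iff, extend_of_lt _ hi, Bool.not_eq_true', descentWord_eq_false,
      lt_iff_of_mem_avoiders_p132_p123 hσ Fin.castSucc_lt_succ]
    have : ∀ k : Fin (m + 1), (⟨i, hi⟩ : Fin m).castSucc ≤ k → k < (⟨i, hi⟩ : Fin m).succ →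
        k = (⟨i, hi⟩ : Fin m).castSucc := fun k h1 h2 => by
      ext
      exact le_antisymm (Nat.le_of_lt_succ h2) h1
    simp only [Bool.not_not, Bool.and_eq_true, Bool.not_eq_true']
    refine and_congr_left fun _ => ⟨fun h => h _ le_rfl Fin.castSucc_lt_succ, ?_⟩
    intro h k h1 h2
    rw [this k h1 h2]
    exact h
  have hC : numTurns σ m = numTrue (changeWord fun i => !(c i && !c (i + 1))) m := by
    refine numTrue_eq_of_eq fun i hi => ?_
    cases i with
    | zero => exact hW 0 hi
    | succ i => rw [changeWord, changeWord, hW _ hi, hW i (by omega)]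
  have hE : ∑ i : Fin m, ((succChange c i).toNat : ℝ) = ((numTrue (succChange c) m : ℕ) : ℝ) := by
    rw [numTrue, Finset.sum_range, Nat.cast_sum]
  have h := abs_numTrue_changeWord_sub_le c m
  rw [← hC] at h
  rw [hE, LAS_eq_numTurns_add_one]
  have h' : |((numTurns σ m + 1 : ℕ) : ℤ) - numTrue (succChange c) m| ≤ 3 := by
    rw [abs_le] at h ⊢
    omega
  exact_mod_cast h'

/-! ### Codings by binary words -/

/-- A coding of each `S_{m+1}(T)` by all binary words of length `m` under which `LAS` is, up to a
bounded error, the number of letters `true`. -/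
def HasBitCoding (T : Set (Equiv.Perm (Fin 3))) : Prop :=
  ∃ C : ℝ, ∀ m : ℕ, ∃ B : Equiv.Perm (Fin (m + 1)) → Fin m → Bool,
    Set.BijOn B (avoiders (m + 1) T) Set.univ ∧
    ∀ σ ∈ avoiders (m + 1) T, |(LAS σ : ℝ) - ∑ i, ((B σ i).toNat : ℝ)| ≤ C

theorem hasBitCoding_of_bijOn_descentWord {T : Set (Equiv.Perm (Fin 3))}
    (h : ∀ m, Set.BijOn descentWord (avoiders (m + 1) T) Set.univ) : HasBitCoding T := by
  refine ⟨1, fun m => ⟨fun σ i => changeWord (extend (descentWord σ)) i,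
    (Set.bijOn_univ.2 (bijective_changeWord m)).comp (h m), fun σ _ => ?_⟩⟩
  rw [LAS_eq_sum_changeWord]
  push_cast
  simp

theorem hasBitCoding_p132_p312 : HasBitCoding {p132, p312} :=
  hasBitCoding_of_bijOn_descentWord bijOn_descentWord_p132_p312

theorem hasBitCoding_p132_p213 : HasBitCoding {p132, p213} :=
  hasBitCoding_of_bijOn_descentWord bijOn_descentWord_p132_p213

theorem hasBitCoding_p132_p123 : HasBitCoding {p132, p123} :=
  ⟨3, fun m => ⟨fun σ i => succChange (extend (nonRecordWord σ)) i,
    (Set.bijOn_univ.2 (bijective_succChange m)).comp (bijOn_nonRecordWord m),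
    fun _ hσ => abs_LAS_sub_sum_succChange_le hσ⟩⟩

/-! ### Variables at bounded distance -/

section Perturbation

variable {Ω : Type*} [MeasurableSpace Ω] {P : Measure Ω} [IsProbabilityMeasure P]

/-- A perturbation by at most `C` changes a variance of order `m` by `O(√m)`. -/
theorem abs_variance_sub_le {X Y : Ω → ℝ} (hX : Measurable X) (hY : MemLp Y 2 P) {C : ℝ}
    (hC : ∀ ω, |X ω - Y ω| ≤ C) {s : ℝ} (hs : 0 < s) :
    |variance X P - variance Y P| ≤ variance Y P / s + C ^ 2 * s + C ^ 2 := by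
  have hD : MemLp (fun ω => X ω - Y ω) 2 P :=
    .of_bound (hX.aestronglyMeasurable.sub hY.aestronglyMeasurable) C (ae_of_all _ hC)
  have hVD : variance (fun ω => X ω - Y ω) P ≤ C ^ 2 := by
    refine (variance_le_sq_of_bounded (a := -C) (b := C)
      (ae_of_all _ fun ω => abs_le.1 (hC ω)) hD.aemeasurable).trans (le_of_eq ?_)
    ring
  have hVD0 := variance_nonneg (fun ω => X ω - Y ω) P
  set D : Ω → ℝ := fun ω => X ω - Y ω with hDdef
  have hXeq : X = fun ω => Y ω + D ω := by
    funext ω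
    simp [hDdef]
  have hVX : variance X P = variance Y P + 2 * covariance Y D P + variance D P := by
    rw [hXeq]
    exact variance_fun_add hY hD
  -- the covariance is bounded by expanding the variance of `Y ± s D`
  have hp := variance_nonneg (fun ω => Y ω + s * D ω) P
  rw [variance_fun_add hY (hD.const_mul s), variance_const_mul, covariance_const_mul_right] at hp
  have hm := variance_nonneg (fun ω => Y ω - s * D ω) P
  rw [variance_fun_sub hY (hD.const_mul s), variance_const_mul, covariance_const_mul_right] at hm
  have hsD : s ^ 2 * variance D P ≤ s ^ 2 * C ^ 2 := mul_le_mul_of_nonneg_left hVD (sq_nonneg s)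
  have hcov : |2 * covariance Y D P| ≤ variance Y P / s + C ^ 2 * s := by
    have he : variance Y P / s + C ^ 2 * s = (variance Y P + s ^ 2 * C ^ 2) / s := by
      field_simp
    rw [he, le_div_iff₀ hs, ← abs_of_pos hs, ← abs_mul, abs_of_pos hs, abs_le]
    constructor <;> linarith
  rw [hVX]
  rw [abs_le] at hcov ⊢
  constructor <;> linarith [sq_nonneg C]

end Perturbation

/-- If `x m = m * c + O(√m)`, then `x m` is asymptotic to `(m + 1) * c`; the shift is that between
the number `m` of tosses and the size `m + 1` of the permutation. -/
theorem tendsto_div_of_abs_sub_le {x : ℕ → ℝ} {c K : ℝ} (hc : 0 < c)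
    (h : ∀ m : ℕ, |x m - m * c| ≤ K * √(m + 1 : ℕ)) :
    Tendsto (fun m : ℕ => x m / ((m + 1 : ℕ) * c)) atTop (𝓝 1) := by
  have h1 : Tendsto (fun m : ℕ => (m : ℝ) / (m + 1 : ℕ)) atTop (𝓝 1) := by
    simpa using tendsto_natCast_div_add_atTop (1 : ℝ)
  have h2 : Tendsto (fun m : ℕ => (x m - m * c) / ((m + 1 : ℕ) * c)) atTop (𝓝 0) := by
    have h3 : Tendsto (fun m : ℕ => K / c * (√(m + 1 : ℕ))⁻¹) atTop (𝓝 0) := by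
      rw [← mul_zero (K / c)]
      exact tendsto_const_nhds.mul (tendsto_inv_atTop_zero.comp
        (Real.tendsto_sqrt_atTop.comp
          (tendsto_natCast_atTop_atTop.comp (tendsto_add_atTop_nat 1))))
    refine squeeze_zero_norm (fun m => ?_) h3
    have hpos : (0 : ℝ) < (m + 1 : ℕ) := by positivity
    have hsq : √((m + 1 : ℕ) : ℝ) * √((m + 1 : ℕ) : ℝ) = (m + 1 : ℕ) := Real.mul_self_sqrt hpos.le
    rw [Real.norm_eq_abs, abs_div, abs_of_pos (mul_pos hpos hc), div_le_iff₀ (mul_pos hpos hc)]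
    refine (h m).trans (le_of_eq ?_)
    have hs0 : √((m + 1 : ℕ) : ℝ) ≠ 0 := (Real.sqrt_pos.2 hpos).ne'
    calc K * √((m + 1 : ℕ) : ℝ)
        = K / c * (√((m + 1 : ℕ) : ℝ))⁻¹ * ((√((m + 1 : ℕ) : ℝ) * √((m + 1 : ℕ) : ℝ)) * c) := by
          field_simp
      _ = _ := by rw [hsq]
  have h4 := h2.add h1
  rw [zero_add] at h4
  refine h4.congr fun m => ?_
  have : ((m + 1 : ℕ) : ℝ) ≠ 0 := by positivity
  field_simp
  ring

/-! ### Coin tossing -/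

/-- Fair coin tossing: the uniform product measure on infinite binary words. -/
noncomputable def coins : Measure (ℕ → Bool) :=
  Measure.infinitePi fun _ => uniformOn (Set.univ : Set Bool)

instance : IsProbabilityMeasure (uniformOn (Set.univ : Set Bool)) :=
  isProbabilityMeasure_uniformOn Set.finite_univ Set.univ_nonempty

instance : IsProbabilityMeasure coins := by unfold coins; infer_instance

/-- The `i`-th toss as a random sign. -/
def toss (i : ℕ) (ω : ℕ → Bool) : ℝ := if ω i then 1 else -1

theorem measurable_toss (i : ℕ) : Measurable (toss i) :=
  (measurable_from_top (f := fun b : Bool => (if b then 1 else -1 : ℝ))).comp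
    (measurable_pi_apply i)

theorem toss_sq (i : ℕ) (ω : ℕ → Bool) : toss i ω ^ 2 = 1 := by
  unfold toss; split_ifs <;> norm_num

theorem abs_toss (i : ℕ) (ω : ℕ → Bool) : |toss i ω| = 1 := by
  unfold toss; split_ifs <;> norm_num

theorem memLp_toss (i : ℕ) : MemLp (toss i) 2 coins :=
  .of_bound (measurable_toss i).aestronglyMeasurable 1 (ae_of_all _ fun ω => (abs_toss i ω).le)

theorem map_eval_coins (i : ℕ) :
    coins.map (fun ω => ω i) = uniformOn (Set.univ : Set Bool) :=
  Measure.infinitePi_map_eval _ i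

theorem integral_toss (i : ℕ) : ∫ ω, toss i ω ∂coins = 0 := by
  have h : ∫ b, (if b then 1 else -1 : ℝ) ∂(uniformOn (Set.univ : Set Bool)) = 0 := by
    have h1 : ∀ b, (uniformOn (Set.univ : Set Bool)).real {b} = 1 / 2 := fun b => by
      rw [measureReal_def, uniformOn_univ, Measure.count_singleton]
      simp
    rw [integral_fintype .of_finite, Fintype.sum_bool, h1, h1]
    simp
  rw [← map_eval_coins i, integral_map (measurable_pi_apply i).aemeasurable
    (measurable_from_top).aestronglyMeasurable] at h
  exact h

theorem iIndepFun_toss : iIndepFun toss coins :=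
  iIndepFun_infinitePi (X := fun _ (b : Bool) => (if b then 1 else -1 : ℝ)) fun _ => measurable_from_top

theorem identDistrib_toss (i : ℕ) : IdentDistrib (toss i) (toss 0) coins coins := by
  have h : IdentDistrib (fun ω : ℕ → Bool => ω i) (fun ω : ℕ → Bool => ω 0) coins coins :=
    ⟨(measurable_pi_apply i).aemeasurable, (measurable_pi_apply 0).aemeasurable, by
      rw [map_eval_coins, map_eval_coins]⟩
  exact h.comp (u := fun b : Bool => (if b then 1 else -1 : ℝ)) measurable_from_top

theorem variance_toss (i : ℕ) : variance (toss i) coins = 1 := by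
  rw [variance_of_integral_eq_zero (measurable_toss i).aemeasurable (integral_toss i)]
  simp [toss_sq]

/-- The number of heads among the first `m` tosses. -/
noncomputable def heads (m : ℕ) (ω : ℕ → Bool) : ℝ := ∑ i : Fin m, ((ω i).toNat : ℝ)

theorem heads_eq (m : ℕ) (ω : ℕ → Bool) :
    heads m ω = 1 / 2 * ∑ i ∈ Finset.range m, toss i ω + m / 2 := by
  rw [heads, Fin.sum_univ_eq_sum_range (fun i => ((ω i).toNat : ℝ)) m, Finset.mul_sum]
  have : ∀ i, ((ω i).toNat : ℝ) = 1 / 2 * toss i ω + 1 / 2 := by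
    intro i
    unfold toss
    cases ω i <;> norm_num
  simp_rw [this, Finset.sum_add_distrib]
  simp
  ring

theorem memLp_sum_toss (m : ℕ) : MemLp (fun ω => ∑ i ∈ Finset.range m, toss i ω) 2 coins :=
  memLp_finsetSum _ fun i _ => memLp_toss i

theorem memLp_heads (m : ℕ) : MemLp (heads m) 2 coins := by
  rw [show heads m = _ from funext (heads_eq m)]
  exact ((memLp_sum_toss m).const_mul _).add (memLp_const _)

theorem integral_heads (m : ℕ) : ∫ ω, heads m ω ∂coins = m * (1 / 2) := by
  simp_rw [heads_eq]
  rw [integral_add (((memLp_sum_toss m).const_mul _).integrable one_le_two) (integrable_const _),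
    integral_const_mul, integral_finsetSum _ fun i _ => (memLp_toss i).integrable one_le_two]
  simp [integral_toss]
  ring

theorem variance_heads (m : ℕ) : variance (heads m) coins = m * (1 / 4) := by
  rw [show heads m = _ from funext (heads_eq m),
    variance_add_const ((memLp_sum_toss m).const_mul _).aestronglyMeasurable, variance_const_mul]
  have h := IndepFun.variance_sum (s := Finset.range m) (fun i _ => memLp_toss i)
    fun i _ j _ hij => iIndepFun_toss.indepFun hij
  have h' : (fun ω => ∑ i ∈ Finset.range m, toss i ω) = ∑ i ∈ Finset.range m, toss i := by
    funext ω
    simp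
  rw [h', h]
  simp [variance_toss]
  ring

section BoundedError

variable {L : ℕ → (ℕ → Bool) → ℝ} {C : ℝ}

theorem abs_integral_sub_le (hL : ∀ m, Measurable (L m)) (hC : ∀ m ω, |L m ω - heads m ω| ≤ C)
    (m : ℕ) : |∫ ω, L m ω ∂coins - m * (1 / 2)| ≤ C := by
  have hH := (memLp_heads m).integrable one_le_two
  have hD : Integrable (fun ω => L m ω - heads m ω) coins :=
    .of_bound ((hL m).aestronglyMeasurable.sub hH.aestronglyMeasurable) C (ae_of_all _ (hC m))
  have hLi : Integrable (L m) coins := (hD.add hH).congr (ae_of_all _ fun ω => by simp)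
  rw [← integral_heads, ← integral_sub hLi hH]
  simpa using norm_integral_le_of_norm_le_const (μ := coins)
    (f := fun ω => L m ω - heads m ω) (ae_of_all _ (hC m))

theorem tendsto_integral_div (hL : ∀ m, Measurable (L m))
    (hC : ∀ m ω, |L m ω - heads m ω| ≤ C) :
    Tendsto (fun m : ℕ => (∫ ω, L m ω ∂coins) / ((m + 1 : ℕ) * (1 / 2))) atTop (𝓝 1) := by
  have hC0 : 0 ≤ C := (abs_nonneg _).trans (hC 0 fun _ => false)
  refine tendsto_div_of_abs_sub_le (K := C) (by norm_num) fun m =>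
    (abs_integral_sub_le hL hC m).trans ?_
  have : 1 ≤ √((m + 1 : ℕ) : ℝ) := Real.one_le_sqrt.2 (by simp)
  nlinarith

theorem tendsto_variance_div (hL : ∀ m, Measurable (L m))
    (hC : ∀ m ω, |L m ω - heads m ω| ≤ C) :
    Tendsto (fun m : ℕ => variance (L m) coins / ((m + 1 : ℕ) * (1 / 4))) atTop (𝓝 1) := by
  refine tendsto_div_of_abs_sub_le (K := 1 / 4 + C ^ 2 + C ^ 2) (by norm_num) fun m => ?_
  have hs : 1 ≤ √((m + 1 : ℕ) : ℝ) := Real.one_le_sqrt.2 (by simp)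
  have h := abs_variance_sub_le (hL m) (memLp_heads m) (hC m) (zero_lt_one.trans_le hs)
  rw [variance_heads] at h
  refine h.trans ?_
  have h1 : (m * (1 / 4) : ℝ) / √((m + 1 : ℕ) : ℝ) ≤ 1 / 4 * √((m + 1 : ℕ) : ℝ) := by
    rw [div_le_iff₀ (zero_lt_one.trans_le hs), mul_assoc, Real.mul_self_sqrt (by positivity)]
    push_cast
    linarith
  nlinarith [sq_nonneg C]

theorem tendsto_sqrt_variance_div (hL : ∀ m, Measurable (L m))
    (hC : ∀ m ω, |L m ω - heads m ω| ≤ C) :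
    Tendsto (fun m : ℕ => √(variance (L m) coins) / (√(m + 1 : ℕ) / 2)) atTop (𝓝 1) := by
  have h := (Real.continuous_sqrt.tendsto 1).comp (tendsto_variance_div hL hC)
  rw [Real.sqrt_one] at h
  refine h.congr fun m => ?_
  rw [Function.comp_apply, Real.sqrt_div (variance_nonneg _ _), Real.sqrt_mul (by positivity),
    show (1 / 4 : ℝ) = (1 / 2) ^ 2 by norm_num, Real.sqrt_sq (by norm_num)]
  congr 1
  ring

/-- The central limit theorem for coin tossing, transferred by Slutsky's theorem to variables at
bounded distance from the number of heads. -/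
theorem tendsto_standardized_le (hL : ∀ m, Measurable (L m))
    (hC : ∀ m ω, |L m ω - heads m ω| ≤ C) (t : ℝ) :
    Tendsto (fun m : ℕ => coins.real
      {ω | (L m ω - ∫ ω', L m ω' ∂coins) / √(variance (L m) coins) ≤ t})
      atTop (𝓝 (cdf (gaussianReal 0 1) t)) := by
  have hclt := tendstoInDistribution_inv_sqrt_mul_sum (P := coins) (X := toss)
    (HasLaw.id (μ := gaussianReal 0 1)) (integral_toss 0) (by simp [toss_sq]) iIndepFun_toss
    identDistrib_toss
  -- `(L - E L) / SD = a * (Y + r)` with `Y` the normalized sum of tosses, `a → 1` and `r → 0`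
  set a : ℕ → ℝ := fun m => √m / 2 / √(variance (L m) coins) with ha
  set r : ℕ → (ℕ → Bool) → ℝ := fun m ω =>
    2 * (√m)⁻¹ * ((L m ω - heads m ω) - (∫ ω', L m ω' ∂coins - m * (1 / 2))) with hr
  have hC0 : 0 ≤ C := (abs_nonneg _).trans (hC 0 fun _ => false)
  have ha_tendsto : Tendsto a atTop (𝓝 1) := by
    have h1 : Tendsto (fun m : ℕ => √((m : ℝ) / (m + 1 : ℕ))) atTop (𝓝 1) := by
      have h := (Real.continuous_sqrt.tendsto 1).comp (tendsto_natCast_div_add_atTop (1 : ℝ))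
      simpa [Function.comp_def] using h
    have h2 := h1.div (tendsto_sqrt_variance_div hL hC) one_ne_zero
    rw [div_one] at h2
    refine h2.congr fun m => ?_
    rw [Pi.div_apply, Real.sqrt_div (by positivity), ha]
    have : √((m + 1 : ℕ) : ℝ) ≠ 0 := (Real.sqrt_pos.2 (by positivity)).ne'
    by_cases h0 : √(variance (L m) coins) = 0
    · simp [h0]
    · field_simp
  have hr_tendsto : ∀ ω, Tendsto (fun m => r m ω) atTop (𝓝 0) := by
    intro ω
    have h1 : Tendsto (fun m : ℕ => (4 * C) * (√(m : ℝ))⁻¹) atTop (𝓝 0) := by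
      rw [← mul_zero (4 * C)]
      exact tendsto_const_nhds.mul (tendsto_inv_atTop_zero.comp
        (Real.tendsto_sqrt_atTop.comp tendsto_natCast_atTop_atTop))
    refine squeeze_zero_norm (fun m => ?_) h1
    have hs : 0 ≤ (√(m : ℝ))⁻¹ := by positivity
    rw [hr, Real.norm_eq_abs, abs_mul, abs_of_nonneg (by positivity)]
    have := (abs_sub (L m ω - heads m ω) (∫ ω', L m ω' ∂coins - m * (1 / 2))).trans
      (add_le_add (hC m ω) (abs_integral_sub_le hL hC m))
    calc _ ≤ 2 * (√(m : ℝ))⁻¹ * (C + C) := mul_le_mul_of_nonneg_left this (by positivity)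
      _ = _ := by ring
  have hr_meas : ∀ m, Measurable (r m) := by
    intro m
    have hh : Measurable (heads m) := by
      rw [show heads m = _ from funext (heads_eq m)]
      have := fun i => measurable_toss i
      fun_prop
    have := hL m
    fun_prop
  have hpair : TendstoInMeasure coins (fun m ω => (a m, r m ω)) atTop fun _ => ((1, 0) : ℝ × ℝ) :=
    tendstoInMeasure_of_tendsto_ae
      (fun m => (measurable_const.prodMk (hr_meas m)).aestronglyMeasurable)
      (ae_of_all _ fun ω => ha_tendsto.prodMk_nhds (hr_tendsto ω))
  have hlim := hclt.continuous_comp_prodMk_of_tendstoInMeasure_const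
    (g := fun p : ℝ × ℝ × ℝ => p.2.1 * (p.1 + p.2.2)) (by fun_prop) hpair
    fun m => (measurable_const.prodMk (hr_meas m)).aemeasurable
  have hport := ProbabilityMeasure.tendsto_measure_of_null_frontier_of_tendsto' hlim.tendsto
    (E := Set.Iic t) (by
      have := nullSingletonClass_gaussianReal (μ := 0) (v := 1) one_ne_zero
      rw [frontier_Iic]
      simp)
  have hcdf : ((gaussianReal 0 1).map fun x : ℝ => ((1, 0) : ℝ × ℝ).1 * (id x + ((1, 0) : ℝ × ℝ).2))
      (Set.Iic t) = (gaussianReal 0 1) (Set.Iic t) := by simp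
  have hport' := (ENNReal.tendsto_toReal (hcdf.trans_ne (measure_ne_top _ _))).comp hport
  rw [cdf_eq_real, measureReal_def, ← hcdf]
  refine hport'.congr' ?_
  filter_upwards [eventually_gt_atTop 0] with m hm
  rw [Function.comp_apply, measureReal_def]
  congr 1
  refine (Measure.map_apply_of_aemeasurable (hlim.forall_aemeasurable m) measurableSet_Iic).trans ?_
  congr 1
  ext ω
  rw [Set.mem_preimage, Set.mem_Iic, Set.mem_ofPred_eq]
  have hm0 : √(m : ℝ) ≠ 0 := (Real.sqrt_pos.2 (by exact_mod_cast hm)).ne'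
  have : a m * ((√(m : ℝ))⁻¹ * ∑ k ∈ Finset.range m, toss k ω + r m ω) =
      (L m ω - ∫ ω', L m ω' ∂coins) / √(variance (L m) coins) := by
    have hh := heads_eq m ω
    have : ∑ k ∈ Finset.range m, toss k ω = 2 * heads m ω - m := by linarith
    rw [this, ha, hr]
    by_cases h0 : √(variance (L m) coins) = 0
    · simp [h0]
    · field_simp
      ring
  rw [this]

end BoundedError

/-! ### Transfer to pattern avoiding permutations -/

/-- The uniform measure on the range of an injective map is the image of the uniform measure. -/
theorem map_uniformOn_univ {α β : Type*} [Fintype α] [Nonempty α] [MeasurableSpace α]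
    [MeasurableSingletonClass α] [MeasurableSpace β] [MeasurableSingletonClass β]
    {e : α → β} (he : Function.Injective e) (hm : Measurable e) :
    (uniformOn (Set.univ : Set α)).map e = uniformOn (Set.range e) := by
  ext s hs
  rw [Measure.map_apply hm hs, uniformOn, uniformOn,
    cond_apply MeasurableSet.univ, cond_apply (Set.finite_range e).measurableSet,
    ← Set.image_preimage_eq_range_inter, ← Set.image_univ, Measure.count_injective_image he,
    Measure.count_injective_image he, Set.univ_inter]

theorem map_coins_restrict (m : ℕ) :
    coins.map (fun ω (i : Fin m) => ω i) = uniformOn (Set.univ : Set (Fin m → Bool)) := by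
  rw [coins, Measure.map_infinitePi_infinitePi_of_inj Fin.val_injective, Measure.infinitePi_eq_pi,
    ← uniformOn_pi, Set.pi_univ]

/-- A bit coding realizes the uniform permutations in `S_{m+1}(T)`, for all `m`, on the space of
infinite coin tossing. -/
theorem HasBitCoding.exists_coupling {T : Set (Equiv.Perm (Fin 3))} (hT : HasBitCoding T) :
    ∃ (C : ℝ) (Φ : ∀ m : ℕ, (ℕ → Bool) → Equiv.Perm (Fin (m + 1))),
      (∀ m, Measurable (Φ m)) ∧ (∀ m, coins.map (Φ m) = unif (m + 1) T) ∧
      ∀ m ω, |(LAS (Φ m ω) : ℝ) - heads m ω| ≤ C := by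
  obtain ⟨C, hC⟩ := hT
  choose B hB hLAS using hC
  have hinv := fun m => (hB m).invOn_invFunOn
  have hmaps := fun m => (hB m).surjOn.mapsTo_invFunOn
  set Ψ : ∀ m, (Fin m → Bool) → Equiv.Perm (Fin (m + 1)) :=
    fun m => Function.invFunOn (B m) (avoiders (m + 1) T) with hΨ
  have hright : ∀ m w, B m (Ψ m w) = w := fun m w => (hinv m).2 (Set.mem_univ w)
  have hrange : ∀ m, Set.range (Ψ m) = avoiders (m + 1) T := fun m =>
    Set.Subset.antisymm (Set.range_subset_iff.2 fun w => hmaps m (Set.mem_univ w))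
      fun σ hσ => ⟨B m σ, (hinv m).1 hσ⟩
  have hmeas : ∀ m, Measurable (Ψ m) := fun m => measurable_of_finite _
  refine ⟨C, fun m ω => Ψ m fun i => ω i, fun m => (hmeas m).comp (by fun_prop), fun m => ?_,
    fun m ω => ?_⟩
  · have h := Measure.map_map (μ := coins) (hmeas m)
      (show Measurable fun (ω : ℕ → Bool) (i : Fin m) => ω i by fun_prop)
    rw [map_coins_restrict, map_uniformOn_univ (Function.LeftInverse.injective (hright m)) (hmeas m),
      hrange] at h
    exact h.symm
  · have h := hLAS m _ (hmaps m (Set.mem_univ fun i : Fin m => ω i))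
    rw [hright] at h
    exact h

theorem HasBitCoding.asymptotics {T : Set (Equiv.Perm (Fin 3))} (hT : HasBitCoding T) :
    AsympNormalLAS T ∧ AsympEq (fun n => meanLAS n T) (fun n => (n : ℝ) / 2) ∧
      AsympEq (fun n => sdLAS n T) (fun n => Real.sqrt n / 2) := by
  obtain ⟨C, Φ, hΦ, hmap, hC⟩ := hT.exists_coupling
  set L : ℕ → (ℕ → Bool) → ℝ := fun m ω => (LAS (Φ m ω) : ℝ)
  have hmeas : ∀ m, Measurable fun σ : Equiv.Perm (Fin (m + 1)) => (LAS σ : ℝ) :=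
    fun m => measurable_of_finite _
  have hL : ∀ m, Measurable (L m) := fun m => (hmeas m).comp (hΦ m)
  have hmean : ∀ m, meanLAS (m + 1) T = ∫ ω, L m ω ∂coins := fun m => by
    rw [meanLAS, ← hmap, integral_map (hΦ m).aemeasurable (hmeas m).aestronglyMeasurable]
  have hsd : ∀ m, sdLAS (m + 1) T = √(variance (L m) coins) := fun m => by
    rw [sdLAS, ← hmap, variance_map (hmeas m).aemeasurable (hΦ m).aemeasurable]
    rfl
  refine ⟨fun t => ?_, ?_, ?_⟩
  · rw [← tendsto_add_atTop_iff_nat 1]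
    refine (tendsto_standardized_le hL hC t).congr fun m => ?_
    rw [hmean, hsd, ← hmap, map_measureReal_apply (hΦ m) (Set.toFinite _).measurableSet]
    rfl
  · rw [AsympEq, ← tendsto_add_atTop_iff_nat 1]
    refine (tendsto_integral_div hL hC).congr fun m => ?_
    rw [hmean, div_eq_mul_one_div ((m + 1 : ℕ) : ℝ) 2]
  · rw [AsympEq, ← tendsto_add_atTop_iff_nat 1]
    refine (tendsto_sqrt_variance_div hL hC).congr fun m => ?_
    rw [hsd]

end PermPattern

theorem theorem2 :
    (∀ (n : ℕ) (σ : Equiv.Perm (Fin n)),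
      σ ∈ PermPattern.avoiders n {PermPattern.p132, PermPattern.p321} → PermPattern.LAS σ ≤ 3) ∧
    (∀ (n : ℕ) (σ : Equiv.Perm (Fin n)),
      σ ∈ PermPattern.avoiders n {PermPattern.p132, PermPattern.p231} → PermPattern.LAS σ ≤ 3) ∧
    (∀ T : Set (Equiv.Perm (Fin 3)),
      (T = {PermPattern.p132, PermPattern.p312} ∨
        T = {PermPattern.p132, PermPattern.p123} ∨
        T = {PermPattern.p132, PermPattern.p213}) →
      PermPattern.AsympNormalLAS T ∧
      PermPattern.AsympEq (fun n => PermPattern.meanLAS n T) (fun n => (n : ℝ) / 2) ∧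
      PermPattern.AsympEq (fun n => PermPattern.sdLAS n T) (fun n => Real.sqrt n / 2)) := by
  refine ⟨fun n σ hσ => PermPattern.LAS_le_three_of_mem_avoiders_p132_p321 hσ,
    fun n σ hσ => PermPattern.LAS_le_three_of_mem_avoiders_p132_p231 hσ, ?_⟩
  rintro T (rfl | rfl | rfl)
  · exact PermPattern.hasBitCoding_p132_p312.asymptotics
  · exact PermPattern.hasBitCoding_p132_p123.asymptotics
  · exact PermPattern.hasBitCoding_p132_p213.asymptotics
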